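/- Let $n\ge 1$ and $k\ge 0$, let $X$ be the set of $k$-element subsets of $\{1,\dots,n\}$, and let $\mathcal F$ be the space of functions $X\to\mathbb C$ with the action $\sigma f=f\circ\sigma^{-1}$ of $S_n$. Identify $x\in X$ with the word $w_1\cdots w_n$ in the letters $1,2$ such that $w_p=1$ if and only if $p\in x$, and let $\delta(x)\in\mathcal F$ be the delta function of $x$. For $1\le m\le n$ let $S_m\subseteq S_n$ be the subgroup of the permutations that fix $m+1,\dots,n$ and, for an irreducible complex representation $\lambda$ of $S_m$, let $\mathcal F_{m,\lambda}$ be the $\lambda$-isotypic component of $\mathcal F$ regarded as an $S_m$-module. For a place $p$ and a letter $c$ let $\mathcal F^{p,c}$ be the span of the $\delta(x)$ for those words $x$ that have the letter $c$ in the place $p$. For $1\le i\le n$, irreducible representations $\lambda_m$ of $S_m$ $(1\le m\le i)$ and a word $c_{i+1}\cdots c_n$ in the letters $1,2$, put $$\mathcal F^{c_{i+1}\cdots c_n}_{\lambda_1\cdots\lambda_i}=\mathcal F_{1,\lambda_1}\cap\dots\cap\mathcal F_{i,\lambda_i}\cap\mathcal F^{i+1,c_{i+1}}\cap\dots\cap\mathcal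 F^{n,c_n}.$$ For $1\le j\le n$ let $J_j=(1\,j)+(2\,j)+\dots+(j-1\;j)\in\mathbb C[S_n]$ be the Jucys–Murphy element. Then, for all $i$ with $1\le i\le n$, all such $\lambda_1,\dots,\lambda_i$ and $c_{i+1}\cdots c_n$, and all $j$ with $1\le j\le i$, the space $\mathcal F^{c_{i+1}\cdots c_n}_{\lambda_1\cdots\lambda_i}$ is invariant under $J_j$, and $J_j$ acts on it as multiplication by a scalar. In particular, this holds for each of these spaces that is one-dimensional, so that it is then spanned by a common eigenvector of $J_1,\dots,J_i$. -/

import Mathlib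

noncomputable section

namespace Johnson

/-- The set `X` of `k`-subsets of an `n`-element set. The places `1, …, n` are represented by the
elements `0, …, n - 1` of `Fin n`. -/
abbrev KSet (n k : ℕ) : Type := {x : Finset (Fin n) // x.card = k}

/-- The action of a permutation on a `k`-set: `σ {i₁, …, i_k} = {σ i₁, …, σ i_k}`. -/
def permKSet {n k : ℕ} (σ : Equiv.Perm (Fin n)) (x : KSet n k) : KSet n k :=
  ⟨x.1.map σ.toEmbedding, by rw [Finset.card_map]; exact x.2⟩

theorem permKSet_one {n k : ℕ} (x : KSet n k) : permKSet 1 x = x := by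
  apply Subtype.ext
  ext a
  simp [permKSet]
  rfl

theorem permKSet_mul {n k : ℕ} (σ τ : Equiv.Perm (Fin n)) (x : KSet n k) :
    permKSet (σ * τ) x = permKSet σ (permKSet τ x) := by
  apply Subtype.ext
  ext a
  simp [permKSet]
  rfl

/-- The representation of the symmetric group on the space `𝓕` of complex functions on the
`k`-sets, `σ f = f ∘ σ⁻¹`. -/
def funRep (n k : ℕ) : Representation ℂ (Equiv.Perm (Fin n)) (KSet n k → ℂ) where
  toFun σ :=
    { toFun := fun f x => f (permKSet σ⁻¹ x)
      map_add' := fun _ _ => rfl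
      map_smul' := fun _ _ => rfl }
  map_one' := by
    ext f x
    simp [permKSet_one]
  map_mul' σ τ := by
    apply LinearMap.ext
    intro f
    funext x
    simp [mul_inv_rev, permKSet_mul]

/-- The subgroup `S_m` of `S_n`: the permutations fixing every element but the first `m`. -/
def initialSym (n m : ℕ) : Subgroup (Equiv.Perm (Fin n)) :=
  fixingSubgroup (Equiv.Perm (Fin n)) {p : Fin n | m ≤ p.val}

/-- The isotypic component `𝓕_{m,μ}` of `𝓕`, regarded as an `S_m`-module, for an irreducible
representation `μ` of `S_m`: the sum of all `S_m`-subrepresentations of `𝓕` isomorphic to `μ`. -/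
def isotypic (n k m : ℕ) {V : Type*} [AddCommGroup V] [Module ℂ V]
    (μ : Representation ℂ (initialSym n m) V) : Submodule ℂ (KSet n k → ℂ) :=
  sSup {U | ∃ W : Subrepresentation ((funRep n k).comp (initialSym n m).subtype),
    Nonempty (W.toRepresentation.Equiv μ) ∧ W.toSubmodule = U}

/-- `𝓕_{λ₁ … λ_p} = 𝓕_{1,λ₁} ∩ … ∩ 𝓕_{p,λ_p}`; the index `m : Fin p` stands for the place
`m + 1`, so that `lam m` is a representation of `S_{m+1}`. -/
def chainSpace (n k : ℕ) {p : ℕ} {V : Fin p → Type*} [∀ m, AddCommGroup (V m)]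
    [∀ m, Module ℂ (V m)] (lam : ∀ m : Fin p, Representation ℂ (initialSym n (m.val + 1)) (V m)) :
    Submodule ℂ (KSet n k → ℂ) :=
  ⨅ m : Fin p, isotypic n k (m.val + 1) (lam m)

/-- The alphabet `{1, 2}`. -/
inductive Letter : Type
  | one : Letter
  | two : Letter

/-- The letter at the place `p` of the word of a `k`-set: it is `1` exactly for the elements of
the set. -/
def letterAt {n k : ℕ} (x : KSet n k) (p : Fin n) : Letter :=
  if p ∈ x.1 then Letter.one else Letter.two

/-- The delta function of a `k`-set. -/
def delta {n k : ℕ} (x : KSet n k) : KSet n k → ℂ := Pi.single x 1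

/-- `𝓕^{p,c}`: the span of the delta functions of the words with the letter `c` at the place
`p`. -/
def letterSpace (n k : ℕ) (p : Fin n) (c : Letter) : Submodule ℂ (KSet n k → ℂ) :=
  Submodule.span ℂ {f | ∃ x : KSet n k, letterAt x p = c ∧ f = delta x}

/-- `𝓕^{c_{i+1} … c_n}`, the intersection of the spaces `𝓕^{p,c_p}` over the last `n - i` places
(the elements `p ≥ i` of `Fin n`); it is all of `𝓕` when `i = n`. -/
def wordSpace (n k i : ℕ) (c : {p : Fin n // i ≤ p.val} → Letter) :
    Submodule ℂ (KSet n k → ℂ) :=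
  ⨅ p : {p : Fin n // i ≤ p.val}, letterSpace n k p.1 (c p)

/-- `𝓕_{λ₁ … λ_i}^{c_{i+1} … c_n} = 𝓕_{λ₁ … λ_i} ∩ 𝓕^{c_{i+1} … c_n}`. -/
def chainWordSpace (n k i : ℕ) {V : Fin i → Type*} [∀ m, AddCommGroup (V m)]
    [∀ m, Module ℂ (V m)] (lam : ∀ m : Fin i, Representation ℂ (initialSym n (m.val + 1)) (V m))
    (c : {p : Fin n // i ≤ p.val} → Letter) : Submodule ℂ (KSet n k → ℂ) :=
  chainSpace n k lam ⊓ wordSpace n k i c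

/-- The Jucys–Murphy element of the group algebra, the sum of the transpositions `(m j)` over
`m < j`. With places counted from `1` this is `J_{j+1}`. -/
def jucysMurphy {n : ℕ} (j : Fin n) : MonoidAlgebra ℂ (Equiv.Perm (Fin n)) :=
  ∑ m ∈ Finset.Iio j, MonoidAlgebra.of ℂ (Equiv.Perm (Fin n)) (Equiv.swap m j)

/-- The operator on `𝓕` by which the Jucys–Murphy element acts. -/
def jucysMurphyOp (n k : ℕ) (j : Fin n) : Module.End ℂ (KSet n k → ℂ) :=
  (funRep n k).asAlgebraHom (jucysMurphy j)

end Johnson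

end

namespace Johnson

/-! The sum of all transpositions in `S_m` is central in the group algebra of `S_m`, so by Schur's
lemma it acts as a scalar on each isotypic component of `𝓕` (`exists_funSwapSum_eq_smul`). Up to a
factor 2 and a constant, `J_j` is the difference of these sums for `S_j` and `S_{j-1}`
(`funSwapSum_succ`), hence a scalar on `𝓕_{λ₁ … λ_i}`. A scalar preserves every subspace, so cutting
down by the letters costs nothing. -/

/-- The first `m` places. -/
def initialPlaces (n m : ℕ) : Finset (Fin n) := {p | p.val < m}

theorem mem_initialPlaces {n m : ℕ} {p : Fin n} : p ∈ initialPlaces n m ↔ p.val < m := by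
  simp [initialPlaces]

theorem apply_mem_initialPlaces_iff {n m : ℕ} (σ : initialSym n m) (p : Fin n) :
    p ∈ initialPlaces n m ↔ σ.1 p ∈ initialPlaces n m := by
  have hfix : ∀ q : Fin n, m ≤ q.val → σ.1 q = q :=
    (mem_fixingSubgroup_iff (Equiv.Perm (Fin n))).1 σ.2
  simp only [mem_initialPlaces]
  refine ⟨fun hp => ?_, fun hp => ?_⟩
  · by_contra! h
    have := σ.1.injective (hfix _ h)
    omega
  · by_contra! h
    rw [hfix p h] at hp
    omega

/-- The transposition of two of the first `m` places, as an element of `S_m`. -/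
def initialSwap {n m : ℕ} (a b : initialPlaces n m) : initialSym n m :=
  ⟨Equiv.swap a.1 b.1, (mem_fixingSubgroup_iff _).2 fun p (hp : m ≤ p.val) => by
    have ha := mem_initialPlaces.1 a.2
    have hb := mem_initialPlaces.1 b.2
    exact Equiv.swap_apply_of_ne_of_ne (by rintro rfl; omega) (by rintro rfl; omega)⟩

/-- The permutation of the first `m` places given by an element of `S_m`. -/
def initialPerm {n m : ℕ} (σ : initialSym n m) : initialPlaces n m ≃ initialPlaces n m :=
  σ.1.subtypeEquiv (apply_mem_initialPlaces_iff σ)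

theorem mul_initialSwap {n m : ℕ} (σ : initialSym n m) (a b : initialPlaces n m) :
    σ * initialSwap a b = initialSwap (initialPerm σ a) (initialPerm σ b) * σ :=
  Subtype.ext (Equiv.mul_swap_eq_swap_mul σ.1 a.1 b.1)

section Central

variable {n m : ℕ} {V W : Type*} [AddCommGroup V] [Module ℂ V] [AddCommGroup W] [Module ℂ W]
  {μ : Representation ℂ (initialSym n m) V} {ν : Representation ℂ (initialSym n m) W}

/-- The sum of the transpositions `(a b)` over all pairs of the first `m` places, diagonal pairs
included, acting on a representation of `S_m`. -/
def swapSum (μ : Representation ℂ (initialSym n m) V) : Module.End ℂ V :=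
  ∑ a, ∑ b, μ (initialSwap a b)

theorem swapSum_apply (v : V) : swapSum μ v = ∑ a, ∑ b, μ (initialSwap a b) v := by
  simp [swapSum]

/-- Conjugation by `σ` permutes the transpositions. Summing over all ordered pairs, diagonal
included, lets both indices be reindexed independently. -/
theorem swapSum_comm (σ : initialSym n m) (v : V) : swapSum μ (μ σ v) = μ σ (swapSum μ v) := by
  simp only [swapSum_apply, map_sum]
  simp only [← Module.End.mul_apply, ← map_mul, mul_initialSwap]
  rw [← Equiv.sum_comp (initialPerm σ) fun a => ∑ b, μ (initialSwap a b * σ) v]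
  refine Finset.sum_congr rfl fun a _ => ?_
  rw [← Equiv.sum_comp (initialPerm σ) fun b => μ (initialSwap (initialPerm σ a) b * σ) v]

theorem map_swapSum (e : μ.IntertwiningMap ν) (v : V) : e (swapSum μ v) = swapSum ν (e v) := by
  simp only [swapSum_apply, ← e.isIntertwining]
  simp only [← e.toLinearMap_apply, map_sum]

theorem exists_swapSum_eq_smul [FiniteDimensional ℂ V] (hμ : μ.IsIrreducible) :
    ∃ a : ℂ, ∀ v, swapSum μ v = a • v := by
  let f : μ.IntertwiningMap μ :=
    LinearMap.intertwiningMap_of_isIntertwiningMap μ μ (swapSum μ) swapSum_comm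
  obtain ⟨a, ha⟩ :=
    (Representation.IsIrreducible.algebraMap_intertwiningMap_bijective_of_isAlgClosed (k := ℂ) (ρ := μ)).2 f
  refine ⟨a, fun v => ?_⟩
  have := congrArg (fun g : μ.IntertwiningMap μ => g v) ha
  exact this.symm

end Central

/-- The sum of the transpositions `(a b)` over all pairs of the first `m` places, diagonal pairs
included, acting on `𝓕`. -/
def funSwapSum (n k m : ℕ) : Module.End ℂ (KSet n k → ℂ) :=
  ∑ a ∈ initialPlaces n m, ∑ b ∈ initialPlaces n m, funRep n k (Equiv.swap a b)

theorem funSwapSum_eq_swapSum (n k m : ℕ) :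
    funSwapSum n k m = swapSum ((funRep n k).comp (initialSym n m).subtype) := by
  rw [funSwapSum, swapSum, ← Finset.sum_coe_sort]
  refine Finset.sum_congr rfl fun a _ => ?_
  rw [← Finset.sum_coe_sort]
  rfl

theorem exists_funSwapSum_eq_smul {n k m : ℕ} {V : Type*} [AddCommGroup V] [Module ℂ V]
    {μ : Representation ℂ (initialSym n m) V} (hμ : μ.IsIrreducible) :
    ∃ a : ℂ, ∀ f ∈ isotypic n k m μ, funSwapSum n k m f = a • f := by
  by_cases hV : FiniteDimensional ℂ V
  · obtain ⟨a, ha⟩ := exists_swapSum_eq_smul hμ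
    refine ⟨a, ?_⟩
    -- The vectors on which the two operators agree form a subspace, so each copy of `μ` can be
    -- checked separately.
    suffices isotypic n k m μ ≤ LinearMap.eqLocus (funSwapSum n k m) (a • LinearMap.id) from
      fun f hf => this hf
    refine sSup_le ?_
    rintro _ ⟨W, ⟨e⟩, rfl⟩ f hf
    have hw : swapSum W.toRepresentation ⟨f, hf⟩ = a • ⟨f, hf⟩ := by
      apply e.toLinearEquiv.injective
      rw [map_smul]
      exact (map_swapSum e.toIntertwiningMap _).trans (ha _)
    have hc := congrArg Subtype.val hw
    rw [swapSum_apply] at hc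
    simp only [AddSubmonoidClass.coe_finsetSum] at hc
    change funSwapSum n k m f = a • f
    rw [funSwapSum_eq_swapSum, swapSum_apply]
    exact hc
  -- An infinite-dimensional `μ` has no copy in the finite-dimensional `𝓕`.
  · refine ⟨0, fun f hf => ?_⟩
    have hbot : isotypic n k m μ = ⊥ := by
      refine le_bot_iff.1 (sSup_le ?_)
      rintro _ ⟨W, ⟨e⟩, rfl⟩
      exact absurd (Module.Finite.equiv e.toLinearEquiv) hV
    rw [hbot, Submodule.mem_bot] at hf
    simp [hf]

theorem jucysMurphyOp_eq_sum (n k : ℕ) (j : Fin n) :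
    jucysMurphyOp n k j = ∑ a ∈ initialPlaces n j.val, funRep n k (Equiv.swap a j) := by
  have : initialPlaces n j.val = Finset.Iio j := by
    ext p
    simp [mem_initialPlaces]
  rw [jucysMurphyOp, jucysMurphy, map_sum, this]
  simp only [Representation.asAlgebraHom_of]

/-- The new pairs are `(a, j)` and `(j, a)` with `a < j`, giving `J` twice, and `(j, j)`, giving the
identity. -/
theorem funSwapSum_succ (n k : ℕ) (j : Fin n) :
    funSwapSum n k (j.val + 1) = funSwapSum n k j.val + (2 : ℂ) • jucysMurphyOp n k j + 1 := by
  have hins : initialPlaces n (j.val + 1) = insert j (initialPlaces n j.val) := by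
    ext p
    simp only [mem_initialPlaces, Finset.mem_insert, Fin.ext_iff]
    omega
  have hj : j ∉ initialPlaces n j.val := by simp [mem_initialPlaces]
  have hswap : ∀ a, Equiv.swap j a = Equiv.swap a j := Equiv.swap_comm j
  simp only [funSwapSum, hins, Finset.sum_insert hj, Finset.sum_add_distrib,
    jucysMurphyOp_eq_sum, hswap, Equiv.swap_self]
  rw [two_smul, show (Equiv.refl (Fin n)) = (1 : Equiv.Perm (Fin n)) from rfl, map_one]
  abel

theorem exists_jucysMurphyOp_eq_smul {n k i : ℕ} {V : Fin i → Type*} [∀ m, AddCommGroup (V m)]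
    [∀ m, Module ℂ (V m)] {lam : ∀ m : Fin i, Representation ℂ (initialSym n (m.val + 1)) (V m)}
    (hlam : ∀ m : Fin i, (lam m).IsIrreducible) {j : Fin n} (hj : j.val < i) :
    ∃ a : ℂ, ∀ f ∈ chainSpace n k lam, jucysMurphyOp n k j f = a • f := by
  have hsum : ∀ m ≤ i, ∃ a : ℂ, ∀ f ∈ chainSpace n k lam, funSwapSum n k m f = a • f := by
    rintro (_ | m) hm
    -- There is no `λ₀`, but for `m = 0` the sum is empty.
    · exact ⟨0, fun f _ => by simp [funSwapSum, initialPlaces]⟩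
    · obtain ⟨a, ha⟩ := exists_funSwapSum_eq_smul (k := k) (hlam ⟨m, hm⟩)
      exact ⟨a, fun f hf => ha f ((Submodule.mem_iInf _).1 hf ⟨m, hm⟩)⟩
  obtain ⟨a, ha⟩ := hsum j.val hj.le
  obtain ⟨b, hb⟩ := hsum (j.val + 1) hj
  refine ⟨(b - a - 1) / 2, fun f hf => ?_⟩
  have h := hb f hf
  rw [funSwapSum_succ] at h
  simp only [LinearMap.add_apply, LinearMap.smul_apply, Module.End.one_apply, ha f hf] at h
  have h2 : (2 : ℂ) • jucysMurphyOp n k j f = (b - a - 1) • f := by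
    rw [sub_smul, sub_smul, one_smul, ← h]
    abel
  rw [div_eq_inv_mul, mul_smul, ← h2, smul_smul, inv_mul_cancel₀ two_ne_zero, one_smul]

end Johnson

theorem mainTheorem11 (n k i : ℕ) (hi : 1 ≤ i) (hin : i ≤ n)
    (V : Fin i → Type*) [∀ m, AddCommGroup (V m)] [∀ m, Module ℂ (V m)]
    (lam : ∀ m : Fin i, Representation ℂ (Johnson.initialSym n (m.val + 1)) (V m))
    (hlam : ∀ m : Fin i, (lam m).IsIrreducible)
    (c : {p : Fin n // i ≤ p.val} → Johnson.Letter)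
    (j : Fin n) (hj : j.val < i) :
    (∀ f ∈ Johnson.chainWordSpace n k i lam c,
      Johnson.jucysMurphyOp n k j f ∈ Johnson.chainWordSpace n k i lam c) ∧
    ∃ a : ℂ, ∀ f ∈ Johnson.chainWordSpace n k i lam c,
      Johnson.jucysMurphyOp n k j f = a • f := by
  obtain ⟨a, ha⟩ := Johnson.exists_jucysMurphyOp_eq_smul (k := k) hlam hj
  refine ⟨fun f hf => ?_, a, fun f hf => ha f hf.1⟩
  rw [ha f hf.1]
  exact Submodule.smul_mem _ a hf
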